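/- Let $n,m\ge 1$ and let $\mathrm{Sym}^2(\mathbb R^n)$ be the space of symmetric real $n\times n$ matrices. Let $\mathfrak g$ be a Gårding–Dirichlet polynomial of degree $m$ on $\mathrm{Sym}^2(\mathbb R^n)$. This means that $\mathfrak g$ is homogeneous of degree $m$ with $\mathfrak g(I)\neq 0$; that for every $A$ all roots of $t\mapsto \mathfrak g(tI+A)$ are real, so that $\mathfrak g(tI+A)=\mathfrak g(I)\prod_{k=1}^m (t+\lambda_k^{\mathfrak g}(A))$ with Gårding eigenvalues $\lambda_1^{\mathfrak g}(A)\le\dots\le\lambda_m^{\mathfrak g}(A)$; and that every $A\ge 0$ lies in the closure of the Gårding cone $\{A:\lambda_k^{\mathfrak g}(A)>0 \text{ for all } k\}$. Let $$\mathbf\Lambda_k^{\mathfrak g}=\{A:\lambda_k^{\mathfrak g}(A)\ge 0\}\quad(k=1,\dots,m)$$ be the Gårding branches, and define $\sigma_j^{\mathfrak g}$ by $\mathfrak g(tI+A)=\mathfrak g(I)\,\bigl(t^m+\sigma_1^{\mathfrak g}(A)t^{m-1}+\cdots+\sigma_m^{\mathfrak g}(A)\bigr)$ and $\sigma_0^{\mathfrak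 g}=1$. For $\theta\in(-m\frac\pi2,m\frac\pi2)$ let $$\mathbf F_\theta^{\mathfrak g}=\Bigl\{A:\sum_{k=1}^m\arctan\lambda_k^{\mathfrak g}(A)\ge\theta\Bigr\}.$$ The asymptotic subequation $\overrightarrow{\mathbf F}$ of a set $\mathbf F\subset\mathrm{Sym}^2(\mathbb R^n)$ is the closure of the set of all $A$ for which there are $\epsilon>0$ and $t_0$ with $t(A-\epsilon I)\in\mathbf F$ for all $t\ge t_0$. The phase intervals are $I_k=\bigl((m-2k)\frac\pi2,(m-2(k-1))\frac\pi2\bigr)$, $k=1,\dots,m$, and the special phases are $\theta_k=(m-2k)\frac\pi2$, $k=1,\dots,m-1$. Then $\sigma_{m-1}^{\mathfrak g}$ is a Gårding–Dirichlet polynomial of degree $m-1$ (a nonzero constant if $m=1$), with branches $\mathbf\Lambda_k^{\sigma_{m-1}^{\mathfrak g}}$, $k=1,\dots,m-1$, and the following hold. 1. If $\theta\in I_k$ with $1\le k\le m$, then $\overrightarrow{\mathbf F}{}_\theta^{\mathfrak g}=\mathbf\Lambda_k^{\mathfrak g}$ and $\operatorname{Int}\overrightarrow{\mathbf F}{}_\theta^{\mathfrak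 g}=\operatorname{Int}\mathbf\Lambda_k^{\mathfrak g}=\{A:\lambda_k^{\mathfrak g}(A)>0\}$. 2. If $1\le k\le m-1$, then $$\overrightarrow{\mathbf F}{}_{\theta_k}^{\mathfrak g}=\mathbf\Lambda_k^{\sigma_{m-1}^{\mathfrak g}}\quad\text{and}\quad \operatorname{Int}\overrightarrow{\mathbf F}{}_{\theta_k}^{\mathfrak g}=\bigl(\operatorname{Int}\mathbf\Lambda_{k+1}^{\mathfrak g}\cap\mathbf\Lambda_k^{\mathfrak g}\bigr)\cup E_k,$$ where $E_k=\bigl(\operatorname{Int}\mathbf\Lambda_{k+1}^{\mathfrak g}\setminus\mathbf\Lambda_k^{\mathfrak g}\bigr)\cap\{A:\sigma_{m-1}^{\mathfrak g}(A)\,\sigma_m^{\mathfrak g}(A)<0\}$. 3. For $k=1,\dots,m$, $\operatorname{Int}\mathbf\Lambda_k^{\sigma_{m-1}^{\mathfrak g}}$ is the disjoint union of $\operatorname{Int}\mathbf\Lambda_{k+1}^{\mathfrak g}\cap\mathbf\Lambda_k^{\mathfrak g}$ and $E_k$. For $k=m$ this uses the convention that a branch whose index exceeds the degree of the polynomial is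 the whole space, that is, $\mathbf\Lambda_{m+1}^{\mathfrak g}=\mathbf\Lambda_m^{\sigma_{m-1}^{\mathfrak g}}=\mathrm{Sym}^2(\mathbb R^n)$. -/

import Mathlib

noncomputable section

open Polynomial

/-- The real vector space of symmetric real `n × n` matrices, with the topology it inherits
from the space of all matrices. -/
def SymMat (n : ℕ) : Submodule ℝ (Matrix (Fin n) (Fin n) ℝ) where
  carrier := {A | A.IsSymm}
  add_mem' := fun ha hb => Matrix.IsSymm.add ha hb
  zero_mem' := Matrix.isSymm_zero
  smul_mem' := fun c _ ha => Matrix.IsSymm.smul ha c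

namespace SymMat

/-- The identity matrix `I`. -/
def id (n : ℕ) : SymMat n := ⟨1, Matrix.isSymm_one⟩

/-- The coordinates `A i j = A j i` of a symmetric matrix, indexed by unordered pairs. -/
def coord {n : ℕ} (A : SymMat n) : Sym2 (Fin n) → ℝ :=
  Sym2.lift ⟨fun i j => A.1 i j, fun i j => Matrix.IsSymm.apply A.2 j i⟩

end SymMat

/-- Polynomials on the space of symmetric `n × n` matrices: the entries on and above the
diagonal are linear coordinates on that space. -/
abbrev SymPoly (n : ℕ) : Type := MvPolynomial (Sym2 (Fin n)) ℝ

namespace SymPoly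

variable {n : ℕ}

/-- The value `g(A)`. -/
def val (g : SymPoly n) (A : SymMat n) : ℝ := MvPolynomial.eval (SymMat.coord A) g

/-- `g(tI + A)` as a polynomial in `t` whose coefficients are polynomials in `A`. -/
def genericLine (g : SymPoly n) : (SymPoly n)[X] :=
  MvPolynomial.aeval
    (fun s : Sym2 (Fin n) =>
      (X : (SymPoly n)[X]) * C (MvPolynomial.C (SymMat.coord (SymMat.id n) s)) + C (MvPolynomial.X s)) g

/-- `g(tI + A)` as a real polynomial in `t`, for a given `A`. -/
def linePoly (g : SymPoly n) (A : SymMat n) : ℝ[X] :=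
  (genericLine g).map (MvPolynomial.eval (SymMat.coord A))

theorem eval_linePoly (g : SymPoly n) (A : SymMat n) (t : ℝ) :
    (linePoly g A).eval t = g.val (t • SymMat.id n + A) := by
  have key : (fun s : Sym2 (Fin n) => t * SymMat.coord (SymMat.id n) s + SymMat.coord A s)
      = SymMat.coord (t • SymMat.id n + A) := by
    funext s
    induction s using Sym2.ind with
    | _ i j => simp [SymMat.coord]
  unfold val
  rw [← key]
  unfold linePoly genericLine
  induction g using MvPolynomial.induction_on with
  | C a => simp [Polynomial.algebraMap_apply, MvPolynomial.algebraMap_eq]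
  | add p q hp hq => simp only [map_add, Polynomial.map_add, Polynomial.eval_add, hp, hq]
  | mul_X p s hp =>
    simp only [map_mul, Polynomial.map_mul, Polynomial.eval_mul, hp, MvPolynomial.aeval_X,
      MvPolynomial.eval_X]
    simp
    exact Or.inl (mul_comm _ _)

/-- The Gårding eigenvalues of `A`: the negatives of the real roots of `t ↦ g(tI + A)`, repeated
according to multiplicity and listed in increasing order. -/
def eigenvalues (g : SymPoly n) (A : SymMat n) : List ℝ :=
  ((linePoly g A).roots.map fun r => -r).sort (· ≤ ·)

/-- The ordered Gårding eigenvalue `λ_k(A)`, `k = 1, 2, …`. If `k` exceeds the number of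
eigenvalues, the value is `0` by convention. -/
def eigenvalue (g : SymPoly n) (k : ℕ) (A : SymMat n) : ℝ :=
  (eigenvalues g A).getD (k - 1) 0

/-- The Gårding branch `Λ_k = {A : λ_k(A) ≥ 0}`. If `k` exceeds the number of eigenvalues, this is
the whole space (there is no condition). -/
def branch (g : SymPoly n) (k : ℕ) : Set (SymMat n) :=
  {A | 0 ≤ eigenvalue g k A}

/-- The (open) Gårding cone: all Gårding eigenvalues are positive. -/
def gardingCone (g : SymPoly n) : Set (SymMat n) :=
  {A | ∀ x ∈ eigenvalues g A, 0 < x}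

/-- `g` is a Gårding–Dirichlet polynomial of degree `m`: it is homogeneous of degree `m`,
hyperbolic with respect to the identity, and the closed Gårding cone contains all positive
semidefinite matrices. -/
structure IsGardingDirichlet (m : ℕ) (g : SymPoly n) : Prop where
  homogeneous : MvPolynomial.IsHomogeneous g m
  val_id_ne_zero : g.val (SymMat.id n) ≠ 0
  splits : ∀ A : SymMat n, (linePoly g A).Splits
  posSemidef_mem : ∀ A : SymMat n, A.1.PosSemidef → A ∈ closure (gardingCone g)

/-- The polynomials `σ_j` (`0 ≤ j ≤ m`) of a polynomial `g` of degree `m`, defined by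
`g(tI + A) = g(I) (t ^ m + σ_1(A) t ^ (m - 1) + ⋯ + σ_m(A))`. -/
def sigma (m : ℕ) (g : SymPoly n) (j : ℕ) : SymPoly n :=
  MvPolynomial.C (g.val (SymMat.id n))⁻¹ * (genericLine g).coeff (m - j)

/-- The special Lagrangian potential operator of `g`: `A ↦ ∑_k arctan λ_k(A)`. -/
def slOperator (m : ℕ) (g : SymPoly n) (A : SymMat n) : ℝ :=
  ∑ k ∈ Finset.Icc 1 m, Real.arctan (eigenvalue g k A)

/-- `F_θ = {A : ∑_k arctan λ_k(A) ≥ θ}`. -/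
def slSubequation (m : ℕ) (g : SymPoly n) (θ : ℝ) : Set (SymMat n) :=
  {A | θ ≤ slOperator m g A}

end SymPoly

/-- The asymptotic interior of `F`: all `A` such that for some `ε > 0` and `t₀` one has
`t (A - ε I) ∈ F` for every `t ≥ t₀`. -/
def asymptoticInterior {n : ℕ} (F : Set (SymMat n)) : Set (SymMat n) :=
  {A | ∃ ε : ℝ, 0 < ε ∧ ∃ t₀ : ℝ, ∀ t : ℝ, t₀ ≤ t → t • (A - ε • SymMat.id n) ∈ F}

/-- The asymptotic subequation of `F`. -/
def asymptoticSubequation {n : ℕ} (F : Set (SymMat n)) : Set (SymMat n) :=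
  closure (asymptoticInterior F)

/-- The special phase `θ_k = (m - 2k) π / 2`. -/
def specialPhase (m k : ℕ) : ℝ := ((m : ℝ) - 2 * (k : ℝ)) * (Real.pi / 2)

/-- The phase interval `I_k = ((m - 2k) π / 2, (m - 2(k - 1)) π / 2)`. -/
def phaseInterval (m k : ℕ) : Set ℝ :=
  Set.Ioo (((m : ℝ) - 2 * (k : ℝ)) * (Real.pi / 2))
    (((m : ℝ) - 2 * ((k : ℝ) - 1)) * (Real.pi / 2))

/-- The part `E_k` of the interior of the `k`-th branch of `σ_{m-1}` outside `Λ_k`. -/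
def exceptionalPart {n : ℕ} (m : ℕ) (g : SymPoly n) (k : ℕ) : Set (SymMat n) :=
  (interior (g.branch (k + 1)) \ g.branch k) ∩
    {A | (SymPoly.sigma m g (m - 1)).val A * (SymPoly.sigma m g m).val A < 0}

end

/-!
Restricted to a line in the direction of the identity, the polynomial `g` is real-rooted,
`g(tI + A) = g(I) ∏ (t + λ_k(A))`, so `λ_k(A - εI) = λ_k(A) - ε` and `λ_k(tA) = t λ_k(A)` for
`t > 0`. Whether `A` is in the asymptotic interior of `F_θ` therefore depends on the sum of the
`arctan (t (λ_k(A) - ε))` for large `t`.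

As `t → ∞` this sum tends to `π / 2` times the number of positive minus the number of negative
`λ_k(A) - ε`. For `θ` in the open interval `I_k` comparison with this limit gives exactly
`{λ_k > 0}` (`asymptoticInterior_of_mem_phaseInterval`). For the special phase `θ_k` the limit can
equal `θ_k`, namely when `λ_k < ε < λ_{k+1}`; then `arctan x = ± π / 2 - arctan x⁻¹` turns the
question into the sign of `∑ (λ_i(A) - ε)⁻¹`, the logarithmic derivative of `t ↦ g(tI + A)` at
`t = -ε`.

Since `σ_{m-1}(tI + A)` is the derivative of `g(tI + A) / g(I)` in `t` (`linePoly_sigma`), Rolle's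
theorem with multiplicities (`exists_interlacing_derivative_prod`) shows that `σ_{m-1}` is again
Gårding–Dirichlet, with eigenvalues `μ_k` interlacing the `λ_k`. A sum of simple poles is strictly
monotone between neighbouring poles, so if `λ_k < 0 < λ_{k+1}`, the logarithmic derivative at `0`
has the sign of `-μ_k` (`sign_sum_inv`). This gives `{μ_k > 0}` at the special phase
(`asymptoticInterior_specialPhase`), and the description of `{μ_k > 0}` by `λ_k`, `λ_{k+1}` and the
sign of `σ_{m-1} σ_m` (`eigenvalue_sigma_pos_iff`).

To pass to closures and interiors one needs that the ordered eigenvalues are continuous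
(`continuous_eigenvalue`); shifting by multiples of the identity then shows that `{λ_k > 0}` is the
interior of the branch `Λ_k` and has closure `Λ_k`. Neither convexity of the Gårding cone nor
monotonicity of the eigenvalues is involved.
-/

noncomputable section

open Polynomial

/-! ### Interlacing for a real-rooted polynomial and its derivative -/

/-- Rolle's theorem with multiplicities: if `a` is increasing, then the derivative of
`∏ (X + a i)` is `(m + 1) ∏ (X + b i)` for an increasing sequence `b` interlacing `a`. -/
theorem exists_interlacing_derivative_prod {m : ℕ} {a : ℕ → ℝ}
    (ha : MonotoneOn a (Set.Icc 1 (m + 1))) :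
    ∃ b : ℕ → ℝ,
      (∀ k ∈ Set.Icc 1 m, a k ≤ b k ∧ b k ≤ a (k + 1) ∧
        (a k < a (k + 1) → a k < b k ∧ b k < a (k + 1))) ∧
      derivative (∏ i ∈ Finset.Icc 1 (m + 1), (X + C (a i))) =
        C ((m : ℝ) + 1) * ∏ i ∈ Finset.Icc 1 m, (X + C (b i)) := by
  classical
  set p : ℝ[X] := ∏ i ∈ Finset.Icc 1 (m + 1), (X + C (a i)) with hp
  have hmonic : p.Monic := monic_prod_of_monic _ _ fun i _ => monic_X_add_C (a i)
  have hdeg : p.natDegree = m + 1 := by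
    rw [hp, natDegree_prod_of_monic _ _ fun i _ => monic_X_add_C (a i)]
    simp
  have hroots : p.roots = (Finset.Icc 1 (m + 1)).val.map fun i => -a i := by
    have h : p = (((Finset.Icc 1 (m + 1)).val.map fun i => -a i).map fun r => X - C r).prod := by
      simp [hp]
    rw [h, roots_multiset_prod_X_sub_C]
  have hroot : ∀ k ∈ Set.Icc 1 (m + 1), p.eval (-a k) = 0 := by
    intro k hk
    rw [hp, eval_prod]
    exact Finset.prod_eq_zero (Finset.mem_Icc.2 hk) (by simp)
  -- `b k` is a critical point between two distinct neighbouring roots, and otherwise the root.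
  have hex : ∀ k, ∃ x, k ∈ Set.Icc 1 m → a k ≤ x ∧ x ≤ a (k + 1) ∧
      (a k < a (k + 1) → (a k < x ∧ x < a (k + 1)) ∧ (derivative p).eval (-x) = 0) := by
    intro k
    by_cases hk : k ∈ Set.Icc 1 m
    · have h1 : k ∈ Set.Icc 1 (m + 1) := ⟨hk.1, hk.2.trans (Nat.le_succ m)⟩
      have h2 : k + 1 ∈ Set.Icc 1 (m + 1) := ⟨by omega, Nat.succ_le_succ hk.2⟩
      rcases (ha h1 h2 (Nat.le_succ k)).eq_or_lt with h | h
      · exact ⟨a k, fun _ => ⟨le_rfl, h.le, fun h' => absurd h h'.ne⟩⟩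
      · obtain ⟨c, hc, hc0⟩ := exists_deriv_eq_zero (f := fun x => p.eval x)
          (neg_lt_neg h) p.continuous.continuousOn (by rw [hroot _ h1, hroot _ h2])
        rw [Polynomial.deriv] at hc0
        have hc1 : a k < -c := by linarith [hc.2]
        have hc2 : -c < a (k + 1) := by linarith [hc.1]
        exact ⟨-c, fun _ => ⟨hc1.le, hc2.le, fun _ => ⟨⟨hc1, hc2⟩, by simpa using hc0⟩⟩⟩
    · exact ⟨0, fun h => absurd h hk⟩
  choose b hb using hex
  refine ⟨b, fun k hk => ⟨(hb k hk).1, (hb k hk).2.1, fun h => ((hb k hk).2.2 h).1⟩, ?_⟩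
  have hcoeff : (derivative p).coeff m = (m : ℝ) + 1 := by
    rw [coeff_derivative, ← hdeg, hmonic.coeff_natDegree, one_mul]
  have hq0 : derivative p ≠ 0 := by
    intro h
    rw [h, coeff_zero] at hcoeff
    linarith [m.cast_nonneg (α := ℝ)]
  have hqdeg : (derivative p).natDegree = m := by
    refine le_antisymm ?_ (le_natDegree_of_ne_zero (by rw [hcoeff]; positivity))
    exact (natDegree_derivative_le p).trans (by omega)
  set M : Multiset ℝ := (Finset.Icc 1 m).val.map fun i => -b i with hM
  have hMle : M ≤ (derivative p).roots := by
    rw [Multiset.le_iff_count]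
    intro r
    rw [count_roots]
    have hcountM : M.count r = ((Finset.Icc 1 m).filter fun i => -b i = r).card := by
      rw [hM, Multiset.count_map]
      simp [Finset.card, eq_comm]
    rw [hcountM]
    set T := (Finset.Icc 1 m).filter fun i => -b i = r with hT
    by_cases hr : p.IsRoot r
    · rw [derivative_rootMultiplicity_of_root hr, ← count_roots, hroots, Multiset.count_map]
      set S := (Finset.Icc 1 (m + 1)).filter fun i => -a i = r with hS
      have hcard : ((Multiset.filter (fun i => r = -a i) (Finset.Icc 1 (m + 1)).val)).card
          = S.card := by
        simp [hS, Finset.card, eq_comm]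
      rw [hcard]
      obtain ⟨j, hj, hjr⟩ : ∃ j ∈ Finset.Icc 1 (m + 1), -a j = r := by
        have : r ∈ p.roots := (mem_roots hmonic.ne_zero).2 hr
        rw [hroots] at this
        simpa using this
      have hSne : S.Nonempty := ⟨j, by simp only [hS, Finset.mem_filter]; exact ⟨hj, hjr⟩⟩
      rw [← Finset.card_erase_of_mem (S.max'_mem hSne)]
      refine Finset.card_le_card fun k hk => ?_
      obtain ⟨hk, hkr⟩ := Finset.mem_filter.1 hk
      rw [Finset.mem_Icc] at hk hj
      have h1 : k ∈ Set.Icc 1 (m + 1) := ⟨hk.1, by omega⟩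
      have h2 : k + 1 ∈ Set.Icc 1 (m + 1) := ⟨by omega, by omega⟩
      have hbk := hb k hk
      -- a root `-a j` of `p` cannot lie strictly between two neighbouring roots
      have hnot : ¬ a k < a (k + 1) := by
        intro h
        have h3 := (hbk.2.2 h).1
        rcases le_or_gt j k with h4 | h4
        · linarith [ha hj h1 h4]
        · linarith [ha h2 hj h4]
      have hle := ha h1 h2 (Nat.le_succ k)
      have hkS : k ∈ S := by
        rw [hS, Finset.mem_filter, Finset.mem_Icc]
        exact ⟨h1, by linarith⟩
      have hkS' : k + 1 ∈ S := by
        rw [hS, Finset.mem_filter, Finset.mem_Icc]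
        exact ⟨h2, by linarith⟩
      refine Finset.mem_erase.2 ⟨fun h => ?_, hkS⟩
      have := S.le_max' _ hkS'
      omega
    · have hne : ∀ i ∈ Set.Icc 1 (m + 1), -a i ≠ r := by
        intro i hi h
        exact hr (h ▸ hroot i hi)
      have hstrict : ∀ k ∈ T, k ∈ Set.Icc 1 m ∧ -b k = r ∧ a k < b k ∧ b k < a (k + 1) ∧
          (derivative p).eval (-b k) = 0 := by
        intro k hk
        obtain ⟨hk, hkr⟩ := Finset.mem_filter.1 hk
        rw [Finset.mem_Icc] at hk
        have h1 : k ∈ Set.Icc 1 (m + 1) := ⟨hk.1, by omega⟩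
        have hbk := hb k hk
        have hlt : a k < a (k + 1) := by
          refine lt_of_le_of_ne (hbk.1.trans hbk.2.1) fun h => hne k h1 ?_
          linarith
        exact ⟨hk, hkr, (hbk.2.2 hlt).1.1, (hbk.2.2 hlt).1.2, (hbk.2.2 hlt).2⟩
      have hone : T.card ≤ 1 := by
        rw [Finset.card_le_one]
        have key : ∀ i ∈ T, ∀ j ∈ T, ¬ i < j := by
          intro i hi j hj hij
          obtain ⟨hi1, hi2, hi3, hi4, -⟩ := hstrict i hi
          obtain ⟨hj1, hj2, hj3, hj4, -⟩ := hstrict j hj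
          have := ha (a := i + 1) ⟨by omega, Nat.succ_le_succ hi1.2⟩ (b := j)
            ⟨hj1.1, hj1.2.trans (Nat.le_succ m)⟩ hij
          linarith
        intro i hi j hj
        have := key i hi j hj
        have := key j hj i hi
        omega
      rcases T.eq_empty_or_nonempty with h | ⟨k, hk⟩
      · simp [h]
      · refine hone.trans ?_
        obtain ⟨-, hkr, -, -, h0⟩ := hstrict k hk
        rw [hkr] at h0
        exact (rootMultiplicity_pos hq0).2 h0
  have hMcard : M.card = m := by simp [hM]
  have hMeq : M = (derivative p).roots := by
    refine Multiset.eq_of_le_of_card_le hMle ?_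
    rw [hMcard]
    exact (card_roots' _).trans hqdeg.le
  have hfac := C_leadingCoeff_mul_prod_multiset_X_sub_C
    (p := derivative p) (by rw [← hMeq, hMcard, hqdeg])
  rw [← hfac, leadingCoeff, hqdeg, hcoeff, ← hMeq]
  simp [hM]

/-- Between two neighbouring poles, a sum of simple poles is strictly monotone. -/
theorem sum_inv_sub_strictMonoOn {m k : ℕ} {a : ℕ → ℝ} (ha : MonotoneOn a (Set.Icc 1 (m + 1)))
    (hk : k ∈ Set.Icc 1 m) :
    StrictMonoOn (fun x => ∑ i ∈ Finset.Icc 1 (m + 1), (a i - x)⁻¹) (Set.Ioo (a k) (a (k + 1))) := by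
  have h1 : k ∈ Set.Icc 1 (m + 1) := ⟨hk.1, hk.2.trans (Nat.le_succ m)⟩
  have h2 : k + 1 ∈ Set.Icc 1 (m + 1) := ⟨by omega, Nat.succ_le_succ hk.2⟩
  intro x hx y hy hxy
  refine Finset.sum_lt_sum_of_nonempty ⟨1, by simp⟩ fun i hi => ?_
  rw [Finset.mem_Icc] at hi
  rcases le_or_gt i k with h | h
  · have h3 := ha hi h1 h
    exact inv_lt_inv_of_neg (by linarith [hx.1]) (by linarith [hy.1]) |>.2 (by linarith)
  · have h3 := ha h2 hi h
    exact inv_strictAnti₀ (by linarith [hy.2]) (by linarith)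

/-- The logarithmic derivative of a product of linear factors. -/
theorem eval_derivative_prod_X_add_C {s : Finset ℕ} {a : ℕ → ℝ} {t : ℝ}
    (h : ∀ i ∈ s, t + a i ≠ 0) :
    (derivative (∏ i ∈ s, (X + C (a i)))).eval t =
      (∏ i ∈ s, (t + a i)) * ∑ i ∈ s, (t + a i)⁻¹ := by
  classical
  rw [derivative_prod_finset, eval_finsetSum, Finset.mul_sum]
  refine Finset.sum_congr rfl fun i hi => ?_
  rw [← Finset.mul_prod_erase s _ hi]
  simp only [derivative_add, derivative_X, derivative_C, add_zero, mul_one, eval_prod, eval_add,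
    eval_X, eval_C]
  field_simp [h i hi]

/-- The sign of the parameter `b k` of the derivative lying between `a k < 0 < a (k + 1)` is read off from
the logarithmic derivative at `0`. -/
theorem sign_sum_inv {m k : ℕ} {a b : ℕ → ℝ} (ha : MonotoneOn a (Set.Icc 1 (m + 1)))
    (hk : k ∈ Set.Icc 1 m) (hb : a k < a (k + 1) → a k < b k ∧ b k < a (k + 1))
    (hder : derivative (∏ i ∈ Finset.Icc 1 (m + 1), (X + C (a i))) =
      C ((m : ℝ) + 1) * ∏ i ∈ Finset.Icc 1 m, (X + C (b i)))
    (hneg : a k < 0) (hpos : 0 < a (k + 1)) :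
    (∑ i ∈ Finset.Icc 1 (m + 1), (a i)⁻¹ < 0 ↔ 0 < b k) ∧
      (∑ i ∈ Finset.Icc 1 (m + 1), (a i)⁻¹ ≤ 0 ↔ 0 ≤ b k) := by
  have h1 : k ∈ Set.Icc 1 (m + 1) := ⟨hk.1, hk.2.trans (Nat.le_succ m)⟩
  have h2 : k + 1 ∈ Set.Icc 1 (m + 1) := ⟨by omega, Nat.succ_le_succ hk.2⟩
  have hbk := hb (hneg.trans hpos)
  have hne : ∀ i ∈ Finset.Icc 1 (m + 1), -b k + a i ≠ 0 := by
    intro i hi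
    rw [Finset.mem_Icc] at hi
    rcases le_or_gt i k with h | h
    · exact ne_of_lt (by linarith [ha hi h1 h])
    · exact ne_of_gt (by linarith [ha h2 hi h])
  have hzero : ∑ i ∈ Finset.Icc 1 (m + 1), (a i - b k)⁻¹ = 0 := by
    have h3 := eval_derivative_prod_X_add_C hne
    rw [hder, eval_mul, eval_prod, Finset.prod_eq_zero (Finset.mem_Icc.2 hk) (by simp),
      mul_zero, eq_comm, mul_eq_zero, Finset.prod_eq_zero_iff] at h3
    rcases h3 with ⟨i, hi, h⟩ | h
    · exact absurd h (hne i hi)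
    · simpa [sub_eq_neg_add] using h
  have hmono := sum_inv_sub_strictMonoOn ha hk
  have hlt := hmono.lt_iff_lt (a := 0) ⟨hneg, hpos⟩ (b := b k) hbk
  have hle := hmono.le_iff_le (a := 0) ⟨hneg, hpos⟩ (b := b k) hbk
  simp only [hzero, sub_zero] at hlt hle
  exact ⟨hlt, hle⟩

/-! ### Sums of arctangents along rays -/

open Filter Topology in
theorem tendsto_sum_arctan_mul (s : Finset ℕ) (b : ℕ → ℝ) :
    Tendsto (fun t : ℝ => ∑ i ∈ s, Real.arctan (t * b i)) atTop
      (𝓝 ((∑ i ∈ s, (SignType.sign (b i) : ℝ)) * (Real.pi / 2))) := by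
  rw [Finset.sum_mul]
  refine tendsto_finsetSum _ fun i _ => ?_
  rcases lt_trichotomy (b i) 0 with h | h | h
  · rw [sign_neg h]
    have := (Real.tendsto_arctan_atBot.mono_right nhdsWithin_le_nhds).comp
      (tendsto_id.atTop_mul_const_of_neg h)
    simpa [Function.comp_def] using this
  · simp [h]
  · rw [sign_pos h]
    have := (Real.tendsto_arctan_atTop.mono_right nhdsWithin_le_nhds).comp
      (tendsto_id.atTop_mul_const h)
    simpa [Function.comp_def] using this

/-- The sign pattern with exactly `j` negative and `m - j` positive entries. -/
theorem sum_ite_neg_one_one {m j : ℕ} (hj : j ≤ m) :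
    ∑ i ∈ Finset.Icc 1 m, (if i ≤ j then (-1 : ℝ) else 1) = (m : ℝ) - 2 * j := by
  induction m, hj using Nat.le_induction with
  | base =>
    rw [Finset.sum_congr rfl fun i hi => if_pos (Finset.mem_Icc.1 hi).2]
    simp
    ring
  | succ m hj ih =>
    rw [Finset.sum_Icc_succ_top (by omega), ih, if_neg (by omega)]
    push_cast
    ring

theorem neg_one_le_sign_coe (x : ℝ) : (-1 : ℝ) ≤ SignType.sign x := by
  rcases lt_trichotomy x 0 with h | h | h <;> simp [h]

theorem sign_coe_le_one (x : ℝ) : (SignType.sign x : ℝ) ≤ 1 := by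
  rcases lt_trichotomy x 0 with h | h | h <;> simp [h]

theorem le_sum_sign {m j : ℕ} {b : ℕ → ℝ} (hb : MonotoneOn b (Set.Icc 1 m)) (hj : j + 1 ≤ m)
    (hpos : 0 < b (j + 1)) :
    (m : ℝ) - 2 * j ≤ ∑ i ∈ Finset.Icc 1 m, (SignType.sign (b i) : ℝ) := by
  rw [← sum_ite_neg_one_one (show j ≤ m by omega)]
  refine Finset.sum_le_sum fun i hi => ?_
  split_ifs with h
  · exact neg_one_le_sign_coe _
  · have := hb (a := j + 1) ⟨by omega, hj⟩ (Finset.mem_Icc.1 hi) (by omega)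
    simp [hpos.trans_le this]

theorem sum_sign_le {m k : ℕ} {b : ℕ → ℝ} (hb : MonotoneOn b (Set.Icc 1 m)) (hk : k ∈ Set.Icc 1 m)
    (hneg : b k < 0) :
    ∑ i ∈ Finset.Icc 1 m, (SignType.sign (b i) : ℝ) ≤ (m : ℝ) - 2 * k := by
  rw [← sum_ite_neg_one_one hk.2]
  refine Finset.sum_le_sum fun i hi => ?_
  split_ifs with h
  · have := hb (Finset.mem_Icc.1 hi) hk h
    simp [this.trans_lt hneg]
  · exact sign_coe_le_one _

theorem sum_sign_lt {m k : ℕ} {b : ℕ → ℝ} (hb : MonotoneOn b (Set.Icc 1 (m + 1)))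
    (hk : k ∈ Set.Icc 1 m) (hneg : b k < 0) (hnonpos : b (k + 1) ≤ 0) :
    ∑ i ∈ Finset.Icc 1 (m + 1), (SignType.sign (b i) : ℝ) < ((m + 1 : ℕ) : ℝ) - 2 * k := by
  rw [← sum_ite_neg_one_one (show k ≤ m + 1 by have := hk.2; omega)]
  refine Finset.sum_lt_sum (fun i hi => ?_) ⟨k + 1, Finset.mem_Icc.2 ⟨by omega,
    Nat.succ_le_succ hk.2⟩, ?_⟩
  · split_ifs with h
    · have := hb (Finset.mem_Icc.1 hi) ⟨hk.1, hk.2.trans (Nat.le_succ m)⟩ h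
      simp [this.trans_lt hneg]
    · exact sign_coe_le_one _
  · rw [if_neg (by omega)]
    rcases hnonpos.lt_or_eq with h | h <;> simp [h]

open Filter Topology in
/-- The first-order term at infinity of a sum of arctangents along a ray. -/
theorem tendsto_mul_sum_arctan_mul_inv (s : Finset ℕ) (b : ℕ → ℝ) :
    Tendsto (fun t : ℝ => t * ∑ i ∈ s, Real.arctan (t * b i)⁻¹) atTop
      (𝓝 (∑ i ∈ s, (b i)⁻¹)) := by
  simp_rw [Finset.mul_sum]
  refine tendsto_finsetSum _ fun i _ => ?_
  have h1 : HasDerivAt (fun x : ℝ => Real.arctan (x * (b i)⁻¹)) (b i)⁻¹ 0 := by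
    have := ((hasDerivAt_id (0 : ℝ)).mul_const (b i)⁻¹).arctan
    simpa using this
  have h2 := h1.tendsto_slope_zero_right.comp tendsto_inv_atTop_nhdsGT_zero
  refine h2.congr fun t => ?_
  simp [mul_comm]

/-- If no `b i` vanishes, the sum of arctangents differs from its limit by arctangents of
reciprocals. -/
theorem sum_arctan_mul_eq {m k : ℕ} {b : ℕ → ℝ} (hb : MonotoneOn b (Set.Icc 1 (m + 1)))
    (hk : k ∈ Set.Icc 1 m) (hneg : b k < 0) (hpos : 0 < b (k + 1)) {t : ℝ} (ht : 0 < t) :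
    ∑ i ∈ Finset.Icc 1 (m + 1), Real.arctan (t * b i) =
      specialPhase (m + 1) k - ∑ i ∈ Finset.Icc 1 (m + 1), Real.arctan (t * b i)⁻¹ := by
  rw [specialPhase, ← sum_ite_neg_one_one (show k ≤ m + 1 by have := hk.2; omega),
    Finset.sum_mul, ← Finset.sum_sub_distrib]
  refine Finset.sum_congr rfl fun i hi => ?_
  split_ifs with h
  · have := hb (Finset.mem_Icc.1 hi) ⟨hk.1, hk.2.trans (Nat.le_succ m)⟩ h
    rw [Real.arctan_inv_of_neg (mul_neg_of_pos_of_neg ht (this.trans_lt hneg))]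
    ring
  · have := hb (a := k + 1) ⟨by omega, Nat.succ_le_succ hk.2⟩ (Finset.mem_Icc.1 hi) (by omega)
    rw [Real.arctan_inv_of_pos (mul_pos ht (hpos.trans_le this))]
    ring

/-! ### Restrictions to lines in the direction of the identity -/

namespace SymPoly

variable {n m : ℕ} {g : SymPoly n}

theorem coord_add_smul (c t : ℝ) (A B : SymMat n) (s : Sym2 (Fin n)) :
    SymMat.coord (c • A + t • B) s = c * SymMat.coord A s + t * SymMat.coord B s := by
  induction s using Sym2.ind with
  | _ i j => simp [SymMat.coord]

theorem continuous_val (g : SymPoly n) : Continuous g.val := by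
  refine (MvPolynomial.continuous_eval g).comp (continuous_pi fun s => ?_)
  induction s using Sym2.ind with
  | _ i j => exact (continuous_apply j).comp ((continuous_apply i).comp continuous_subtype_val)

theorem val_smul (hg : g.IsHomogeneous m) (c : ℝ) (A : SymMat n) :
    g.val (c • A) = c ^ m * g.val A := by
  have h : SymMat.coord (c • A) = fun s => c * SymMat.coord A s := by
    funext s
    simpa using coord_add_smul c 0 A A s
  rw [val, val, h, MvPolynomial.eval_eq, MvPolynomial.eval_eq, Finset.mul_sum]
  refine Finset.sum_congr rfl fun d hd => ?_
  simp only [mul_pow]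
  rw [Finset.prod_mul_distrib, Finset.prod_pow_eq_pow_sum, hg.degree_eq_sum_deg_support hd]
  ring

theorem linePoly_eq_aeval (g : SymPoly n) (A : SymMat n) :
    linePoly g A = MvPolynomial.aeval
      (fun s => C (SymMat.coord (SymMat.id n) s) * X + C (SymMat.coord A s)) g := by
  refine Polynomial.funext fun t => ?_
  have h : SymMat.coord (t • SymMat.id n + A) = fun s =>
      (C (SymMat.coord (SymMat.id n) s) * X + C (SymMat.coord A s)).eval t := by
    funext s
    have := coord_add_smul t 1 (SymMat.id n) A s
    rw [one_smul, one_mul] at this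
    rw [this, eval_add, eval_mul, eval_C, eval_X, eval_C, mul_comm]
  rw [eval_linePoly, val, h, ← Polynomial.coe_aeval_eq_eval,
    MvPolynomial.comp_aeval_apply, MvPolynomial.aeval_eq_eval]

/-- The polynomial `g(tI + A)` is homogeneous jointly in `t` and `A`. -/
theorem isHomogeneous_coeff_genericLine (hg : g.IsHomogeneous m) {i j : ℕ} (hij : i + j = m) :
    ((genericLine g).coeff i).IsHomogeneous j := by
  refine MvPolynomial.IsHomogeneous.coeff_isHomogeneous_of_optionEquivLeft_symm (n := m) ?_ i j hij
  have h : (MvPolynomial.optionEquivLeft ℝ (Sym2 (Fin n))).symm (genericLine g) =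
      MvPolynomial.aeval (fun s : Sym2 (Fin n) =>
        (MvPolynomial.X none * MvPolynomial.C (SymMat.coord (SymMat.id n) s) +
          MvPolynomial.X (some s) : MvPolynomial (Option (Sym2 (Fin n))) ℝ)) g := by
    rw [genericLine, ← AlgEquiv.coe_toAlgHom, ← AlgHom.comp_apply, MvPolynomial.comp_aeval]
    congr 2
    funext s
    rw [AlgEquiv.coe_toAlgHom, map_add, map_mul, MvPolynomial.optionEquivLeft_symm_C_X,
      MvPolynomial.optionEquivLeft_symm_C_C, MvPolynomial.optionEquivLeft_symm_X]
  rw [h]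
  have := hg.aeval (n := 1) (fun s : Sym2 (Fin n) =>
        (MvPolynomial.X none * MvPolynomial.C (SymMat.coord (SymMat.id n) s) +
          MvPolynomial.X (some s) : MvPolynomial (Option (Sym2 (Fin n))) ℝ)) fun s =>
    ((MvPolynomial.isHomogeneous_X _ _).mul (MvPolynomial.isHomogeneous_C _ _)).add
      (MvPolynomial.isHomogeneous_X _ _)
  simpa using this

theorem coeff_linePoly (g : SymPoly n) (A : SymMat n) (j : ℕ) :
    (linePoly g A).coeff j = ((genericLine g).coeff j).val A := by
  rw [linePoly, coeff_map]
  rfl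

theorem natDegree_linePoly_le (hg : g.IsHomogeneous m) (A : SymMat n) :
    (linePoly g A).natDegree ≤ m := by
  rw [linePoly_eq_aeval, ← mul_one m]
  exact MvPolynomial.aeval_natDegree_le g hg.totalDegree_le _ fun s => natDegree_linear_le

theorem linePoly_zero (hg : g.IsHomogeneous m) :
    linePoly g 0 = C (g.val (SymMat.id n)) * X ^ m := by
  refine Polynomial.funext fun t => ?_
  rw [eval_linePoly, add_zero, val_smul hg]
  rw [eval_mul, eval_C, eval_pow, eval_X, mul_comm]

/-- The coefficient of `t ^ m` in `g(tI + A)` has degree `0` in `A`, so it can be computed at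
`A = 0`. -/
theorem coeff_linePoly_top (hg : g.IsHomogeneous m) (A : SymMat n) :
    (linePoly g A).coeff m = g.val (SymMat.id n) := by
  have h0 : (linePoly g 0).coeff m = g.val (SymMat.id n) := by simp [linePoly_zero hg]
  have h := isHomogeneous_coeff_genericLine hg (add_zero m)
  have key : ∀ B : SymMat n, (linePoly g ((0 : ℝ) • B)).coeff m = (linePoly g B).coeff m := by
    intro B
    rw [coeff_linePoly, coeff_linePoly, val_smul h, pow_zero, one_mul]
  rw [← key A, zero_smul, h0]

theorem linePoly_add_smul_id (g : SymPoly n) (A : SymMat n) (s : ℝ) :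
    linePoly g (A + s • SymMat.id n) = (linePoly g A).comp (X + C s) := by
  refine Polynomial.funext fun t => ?_
  rw [eval_linePoly, eval_comp, eval_linePoly]
  congr 1
  simp only [eval_add, eval_X, eval_C]
  module

/-! ### Ordered Gårding eigenvalues -/

/-- A factorization of `g(tI + A)` with increasing parameters computes the ordered eigenvalues. -/
theorem eigenvalues_eq {c : ℝ} (hc : c ≠ 0) {a : ℕ → ℝ} (ha : MonotoneOn a (Set.Icc 1 m))
    {A : SymMat n} (h : linePoly g A = C c * ∏ i ∈ Finset.Icc 1 m, (X + C (a i))) :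
    eigenvalues g A = (List.range' 1 m).map a := by
  have hroots : (linePoly g A).roots = (Finset.Icc 1 m).val.map fun i => -a i := by
    have h' : ∏ i ∈ Finset.Icc 1 m, (X + C (a i)) =
        (((Finset.Icc 1 m).val.map fun i => -a i).map fun r => X - C r).prod := by simp
    rw [h, roots_C_mul _ hc, h', roots_multiset_prod_X_sub_C]
  have hrange : (Finset.Icc 1 m).val = (List.range' 1 m : Multiset ℕ) := by
    rw [Nat.Icc_eq_range', Nat.add_sub_cancel]
  rw [eigenvalues, hroots, Multiset.map_map, hrange]
  simp only [Function.comp_def, neg_neg, Multiset.map_coe, Multiset.coe_sort]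
  refine List.mergeSort_eq_self _ ?_
  rw [List.pairwise_map]
  refine (List.pairwise_lt_range' (s := 1) (n := m)).imp_of_mem fun {i j} hi hj hij => ?_
  rw [List.mem_range'_1] at hi hj
  exact ha ⟨hi.1, by omega⟩ ⟨hj.1, by omega⟩ hij.le

theorem eigenvalue_eq {c : ℝ} (hc : c ≠ 0) {a : ℕ → ℝ} (ha : MonotoneOn a (Set.Icc 1 m))
    {A : SymMat n} (h : linePoly g A = C c * ∏ i ∈ Finset.Icc 1 m, (X + C (a i)))
    {k : ℕ} (hk : k ∈ Set.Icc 1 m) : eigenvalue g k A = a k := by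
  obtain ⟨hk1, hk2⟩ := hk
  have hlt : k - 1 < ((List.range' 1 m).map a).length := by
    rw [List.length_map, List.length_range']
    omega
  rw [eigenvalue, eigenvalues_eq hc ha h, List.getD_eq_getElem _ _ hlt]
  simp only [List.getElem_map, List.getElem_range']
  congr 1
  omega

namespace IsGardingDirichlet

theorem natDegree_linePoly (hg : IsGardingDirichlet m g) (A : SymMat n) :
    (linePoly g A).natDegree = m := by
  refine le_antisymm (natDegree_linePoly_le hg.homogeneous A) (le_natDegree_of_ne_zero ?_)
  rw [coeff_linePoly_top hg.homogeneous]
  exact hg.val_id_ne_zero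

theorem length_eigenvalues (hg : IsGardingDirichlet m g) (A : SymMat n) :
    (eigenvalues g A).length = m := by
  rw [eigenvalues, Multiset.length_sort, Multiset.card_map, ← hg.natDegree_linePoly A]
  exact (hg.splits A).natDegree_eq_card_roots.symm

theorem eigenvalue_eq_getElem (hg : IsGardingDirichlet m g) {A : SymMat n} {k : ℕ}
    (hk : k ∈ Set.Icc 1 m) : eigenvalue g k A =
      (eigenvalues g A)[k - 1]'(by
        rw [hg.length_eigenvalues]; have := hk.1; have := hk.2; omega) :=
  List.getD_eq_getElem _ _ _

theorem monotoneOn_eigenvalue (hg : IsGardingDirichlet m g) (A : SymMat n) :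
    MonotoneOn (fun k => eigenvalue g k A) (Set.Icc 1 m) := by
  intro i hi j hj hij
  simp only [hg.eigenvalue_eq_getElem hi, hg.eigenvalue_eq_getElem hj]
  rcases hij.eq_or_lt with rfl | hij
  · exact le_rfl
  · exact List.pairwise_iff_getElem.1 (Multiset.pairwise_sort _ _) _ _ _ _
      (by have := hi.1; omega)

theorem map_range'_eigenvalue (hg : IsGardingDirichlet m g) (A : SymMat n) :
    (List.range' 1 m).map (fun k => eigenvalue g k A) = eigenvalues g A := by
  refine List.ext_getElem (by simp [hg.length_eigenvalues]) fun i hi _ => ?_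
  rw [List.length_map, List.length_range'] at hi
  simp only [List.getElem_map, List.getElem_range', one_mul]
  rw [hg.eigenvalue_eq_getElem ⟨by omega, by omega⟩]
  congr 1
  omega

theorem linePoly_eq (hg : IsGardingDirichlet m g) (A : SymMat n) :
    linePoly g A = C (g.val (SymMat.id n)) *
      ∏ k ∈ Finset.Icc 1 m, (X + C (eigenvalue g k A)) := by
  have h1 := (hg.splits A).eq_prod_roots
  rw [leadingCoeff, hg.natDegree_linePoly, coeff_linePoly_top hg.homogeneous] at h1
  have hprod : ∏ k ∈ Finset.Icc 1 m, (X + C (eigenvalue g k A)) =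
      ((eigenvalues g A : Multiset ℝ).map fun x => X + C x).prod := by
    rw [← hg.map_range'_eigenvalue A, ← Multiset.map_coe, Multiset.map_map, Finset.prod,
      Nat.Icc_eq_range', Nat.add_sub_cancel]
    rfl
  rw [hprod, eigenvalues, Multiset.sort_eq, Multiset.map_map]
  simpa [Function.comp_def, sub_eq_add_neg] using h1

theorem val_smul_id_add (hg : IsGardingDirichlet m g) (A : SymMat n) (t : ℝ) :
    g.val (t • SymMat.id n + A) = g.val (SymMat.id n) *
      ∏ k ∈ Finset.Icc 1 m, (t + eigenvalue g k A) := by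
  rw [← eval_linePoly, hg.linePoly_eq]
  simp [eval_prod]

theorem eigenvalue_eq_of_val (hg : IsGardingDirichlet m g) {A : SymMat n} {a : ℕ → ℝ}
    (ha : MonotoneOn a (Set.Icc 1 m))
    (h : ∀ t : ℝ, g.val (t • SymMat.id n + A) = g.val (SymMat.id n) *
      ∏ k ∈ Finset.Icc 1 m, (t + a k)) {k : ℕ} (hk : k ∈ Set.Icc 1 m) :
    eigenvalue g k A = a k := by
  refine eigenvalue_eq hg.val_id_ne_zero ha (Polynomial.funext fun t => ?_) hk
  rw [eval_linePoly, h]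
  simp [eval_prod]

theorem eigenvalue_add_smul_id (hg : IsGardingDirichlet m g) (A : SymMat n) (s : ℝ) {k : ℕ}
    (hk : k ∈ Set.Icc 1 m) :
    eigenvalue g k (A + s • SymMat.id n) = eigenvalue g k A + s := by
  refine hg.eigenvalue_eq_of_val (a := fun k => eigenvalue g k A + s)
    (fun i hi j hj hij => add_le_add_left (hg.monotoneOn_eigenvalue A hi hj hij) s)
    (fun t => ?_) hk
  have h : t • SymMat.id n + (A + s • SymMat.id n) = (t + s) • SymMat.id n + A := by module
  rw [h, hg.val_smul_id_add]
  congr 1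
  exact Finset.prod_congr rfl fun i _ => by ring

theorem eigenvalue_sub_smul_id (hg : IsGardingDirichlet m g) (A : SymMat n) (s : ℝ) {k : ℕ}
    (hk : k ∈ Set.Icc 1 m) :
    eigenvalue g k (A - s • SymMat.id n) = eigenvalue g k A - s := by
  have h : A - s • SymMat.id n = A + (-s) • SymMat.id n := by module
  rw [h, sub_eq_add_neg]
  exact hg.eigenvalue_add_smul_id A (-s) hk

theorem eigenvalue_smul (hg : IsGardingDirichlet m g) (A : SymMat n) {c : ℝ} (hc : 0 < c) {k : ℕ}
    (hk : k ∈ Set.Icc 1 m) : eigenvalue g k (c • A) = c * eigenvalue g k A := by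
  refine hg.eigenvalue_eq_of_val (a := fun k => c * eigenvalue g k A)
    (fun i hi j hj hij => mul_le_mul_of_nonneg_left (hg.monotoneOn_eigenvalue A hi hj hij) hc.le)
    (fun t => ?_) hk
  have h : t • SymMat.id n + c • A = c • ((t / c) • SymMat.id n + A) := by
    rw [smul_add, smul_smul, mul_div_cancel₀ _ hc.ne']
  have hcard : c ^ m = ∏ _k ∈ Finset.Icc 1 m, c := by simp
  rw [h, val_smul hg.homogeneous, hg.val_smul_id_add, mul_left_comm, hcard,
    ← Finset.prod_mul_distrib]
  congr 1
  refine Finset.prod_congr rfl fun i _ => ?_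
  field_simp

open Filter Topology in
/-- The ordered eigenvalues depend continuously on `A`. Near `A` they are bounded, because
`g(I + sA) ≠ 0` for small `s`; and any limit of eigenvalue tuples is an increasing tuple that
factors `g(tI + A)`. -/
theorem continuous_eigenvalue (hg : IsGardingDirichlet m g) {k : ℕ} (hk : k ∈ Set.Icc 1 m) :
    Continuous (eigenvalue g k) := by
  rw [continuous_iff_continuousAt]
  intro A
  obtain ⟨R, hR⟩ : ∃ R : ℝ, ∀ᶠ B in 𝓝 A, ∀ i ∈ Set.Icc 1 m, eigenvalue g i B ∈ Set.Icc (-R) R := by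
    have hcont : Continuous fun q : ℝ × SymMat n => g.val (SymMat.id n + q.1 • q.2) :=
      (continuous_val g).comp (continuous_const.add (continuous_fst.smul continuous_snd))
    have hne : ∀ᶠ q in 𝓝 ((0 : ℝ), A), g.val (SymMat.id n + q.1 • q.2) ≠ 0 :=
      hcont.continuousAt.eventually_ne (by simpa using hg.val_id_ne_zero)
    rw [nhds_prod_eq] at hne
    obtain ⟨P, hP, Q, hQ, hPQ⟩ := eventually_prod_iff.1 hne
    obtain ⟨δ, hδ, hball⟩ := Metric.eventually_nhds_iff.1 hP
    refine ⟨δ⁻¹, hQ.mono fun B hB i hi => ?_⟩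
    by_contra hcon
    rw [Set.mem_Icc, ← abs_le, not_le] at hcon
    set x := eigenvalue g i B with hx
    have hx0 : x ≠ 0 := fun h => by
      rw [h, abs_zero] at hcon
      exact absurd hcon (not_lt.2 (inv_pos.2 hδ).le)
    have hs : |(-x)⁻¹| < δ := by
      rw [abs_inv, abs_neg]
      exact inv_lt_of_inv_lt₀ hδ hcon
    refine hPQ (hball (by simpa only [dist_zero_right, Real.norm_eq_abs] using hs)) hB ?_
    have h1 : (-x) • (SymMat.id n + (-x)⁻¹ • B) = (-x) • SymMat.id n + B := by
      rw [smul_add, smul_smul, mul_inv_cancel₀ (neg_ne_zero.2 hx0), one_smul]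
    have h2 : g.val ((-x) • SymMat.id n + B) = 0 := by
      rw [hg.val_smul_id_add, Finset.prod_eq_zero (Finset.mem_Icc.2 hi) (by simp [hx]), mul_zero]
    rw [← h1, val_smul hg.homogeneous] at h2
    exact (mul_eq_zero.1 h2).resolve_left (pow_ne_zero _ (neg_ne_zero.2 hx0))
  rw [ContinuousAt, tendsto_iff_ultrafilter]
  intro U hU
  have hlim : ∀ i, ∃ y : ℝ, i ∈ Set.Icc 1 m → Tendsto (eigenvalue g i) U (𝓝 y) := by
    intro i
    by_cases hi : i ∈ Set.Icc 1 m
    · obtain ⟨y, -, hy⟩ := (isCompact_Icc (a := -R) (b := R)).ultrafilter_le_nhds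
        (U.map (eigenvalue g i))
        (le_principal_iff.2 (hU (hR.mono fun B hB => hB i hi)))
      exact ⟨y, fun _ => hy⟩
    · exact ⟨0, fun h => absurd h hi⟩
  choose y hy using hlim
  have hmono : MonotoneOn y (Set.Icc 1 m) := fun i hi j hj hij =>
    le_of_tendsto_of_tendsto' (hy i hi) (hy j hj) fun B => hg.monotoneOn_eigenvalue B hi hj hij
  have hval : ∀ t : ℝ, g.val (t • SymMat.id n + A) = g.val (SymMat.id n) *
      ∏ k ∈ Finset.Icc 1 m, (t + y k) := by
    intro t
    have h1 : Tendsto (fun B => g.val (t • SymMat.id n + B)) U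
        (𝓝 (g.val (t • SymMat.id n + A))) :=
      (((continuous_val g).comp (continuous_const.add continuous_id)).tendsto A).mono_left hU
    refine tendsto_nhds_unique h1 ?_
    simp_rw [hg.val_smul_id_add]
    exact (tendsto_finsetProd _ fun i hi =>
      (hy i (Finset.mem_Icc.1 hi)).const_add t).const_mul _
  rw [hg.eigenvalue_eq_of_val hmono hval hk]
  exact hy k hk

/-! ### Topology of the branches -/

theorem branch_of_lt (hg : IsGardingDirichlet m g) {k : ℕ} (hk : m < k) :
    g.branch k = Set.univ := by
  refine Set.eq_univ_of_forall fun A => ?_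
  change 0 ≤ (eigenvalues g A).getD (k - 1) 0
  rw [List.getD_eq_default _ _ (by rw [hg.length_eigenvalues]; omega)]

open Filter Topology in
theorem closure_eigenvalue_pos (hg : IsGardingDirichlet m g) {k : ℕ} (hk : k ∈ Set.Icc 1 m) :
    closure {A | 0 < g.eigenvalue k A} = g.branch k := by
  refine (closure_minimal (fun A (hA : 0 < g.eigenvalue k A) => hA.le) ?_).antisymm fun A hA => ?_
  · exact isClosed_le continuous_const (hg.continuous_eigenvalue hk)
  · have h : Tendsto (fun s : ℝ => A + s • SymMat.id n) (𝓝[>] 0) (𝓝 A) := by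
      have : Continuous fun s : ℝ => A + s • SymMat.id n := by fun_prop
      simpa using (this.tendsto 0).mono_left nhdsWithin_le_nhds
    refine mem_closure_of_tendsto h (eventually_nhdsWithin_of_forall fun s hs => ?_)
    change 0 < g.eigenvalue k _
    rw [hg.eigenvalue_add_smul_id A s hk]
    exact add_pos_of_nonneg_of_pos hA hs

open Filter Topology in
theorem interior_branch (hg : IsGardingDirichlet m g) {k : ℕ} (hk : k ∈ Set.Icc 1 m) :
    interior (g.branch k) = {A | 0 < g.eigenvalue k A} := by
  refine Set.Subset.antisymm (fun A hA => ?_) (interior_maximal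
    (fun A (hA : 0 < g.eigenvalue k A) => hA.le)
    (isOpen_lt continuous_const (hg.continuous_eigenvalue hk)))
  have h : Tendsto (fun s : ℝ => A - s • SymMat.id n) (𝓝[>] 0) (𝓝 A) := by
    have : Continuous fun s : ℝ => A - s • SymMat.id n := by fun_prop
    simpa using (this.tendsto 0).mono_left nhdsWithin_le_nhds
  obtain ⟨s, hs, hs0⟩ := ((h.eventually (mem_interior_iff_mem_nhds.1 hA)).and
    self_mem_nhdsWithin).exists
  change 0 ≤ g.eigenvalue k _ at hs
  rw [hg.eigenvalue_sub_smul_id A s hk] at hs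
  exact hs0.trans_le (sub_nonneg.1 hs)

end IsGardingDirichlet

/-! ### The polynomial `σ_{m-1}` as a directional derivative -/

/-- Up to the factor `g(I)`, the penultimate `σ_j` is the derivative of `g` in the direction `I`. -/
theorem linePoly_sigma_penultimate (g : SymPoly n) (A : SymMat n) :
    linePoly (sigma (m + 1) g m) A = C (g.val (SymMat.id n))⁻¹ * derivative (linePoly g A) := by
  refine Polynomial.funext fun t => ?_
  have h : (sigma (m + 1) g m).val (t • SymMat.id n + A) =
      (g.val (SymMat.id n))⁻¹ * (linePoly g (A + t • SymMat.id n)).coeff 1 := by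
    rw [coeff_linePoly, sigma, Nat.add_sub_cancel_left, add_comm A]
    simp [val]
  rw [eval_linePoly, h, linePoly_add_smul_id, ← taylor_apply, taylor_coeff_one, eval_mul, eval_C]

namespace IsGardingDirichlet

theorem val_sigma_top (hg : IsGardingDirichlet m g) (A : SymMat n) :
    (sigma m g m).val A = ∏ k ∈ Finset.Icc 1 m, eigenvalue g k A := by
  have h : (sigma m g m).val A = (g.val (SymMat.id n))⁻¹ * (linePoly g A).eval 0 := by
    rw [← coeff_zero_eq_eval_zero, coeff_linePoly, sigma, Nat.sub_self]
    simp [val]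
  rw [h, hg.linePoly_eq, eval_mul, eval_C, inv_mul_cancel_left₀ hg.val_id_ne_zero]
  simp [eval_prod]

theorem linePoly_sigma (hg : IsGardingDirichlet (m + 1) g) (A : SymMat n) :
    linePoly (sigma (m + 1) g m) A =
      derivative (∏ k ∈ Finset.Icc 1 (m + 1), (X + C (eigenvalue g k A))) := by
  rw [linePoly_sigma_penultimate, hg.linePoly_eq, derivative_C_mul, ← mul_assoc, ← C_mul,
    inv_mul_cancel₀ hg.val_id_ne_zero, C_1, one_mul]

/-- The eigenvalues of the penultimate `σ_j` interlace those of `g`. -/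
theorem interlacing (hg : IsGardingDirichlet (m + 1) g) (A : SymMat n) {k : ℕ}
    (hk : k ∈ Set.Icc 1 m) :
    g.eigenvalue k A ≤ (sigma (m + 1) g m).eigenvalue k A ∧
      (sigma (m + 1) g m).eigenvalue k A ≤ g.eigenvalue (k + 1) A ∧
      (g.eigenvalue k A < g.eigenvalue (k + 1) A →
        g.eigenvalue k A < (sigma (m + 1) g m).eigenvalue k A) ∧
      (g.eigenvalue k A < 0 → 0 < g.eigenvalue (k + 1) A →
        (∑ i ∈ Finset.Icc 1 (m + 1), (g.eigenvalue i A)⁻¹ < 0 ↔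
          0 < (sigma (m + 1) g m).eigenvalue k A) ∧
        (∑ i ∈ Finset.Icc 1 (m + 1), (g.eigenvalue i A)⁻¹ ≤ 0 ↔
          0 ≤ (sigma (m + 1) g m).eigenvalue k A)) := by
  have ha := hg.monotoneOn_eigenvalue A
  obtain ⟨b, hb, hder⟩ := exists_interlacing_derivative_prod ha
  have hbmono : MonotoneOn b (Set.Icc 1 m) := by
    intro i hi j hj hij
    rcases hij.eq_or_lt with rfl | hij
    · exact le_rfl
    · exact ((hb i hi).2.1.trans (ha ⟨by omega, Nat.succ_le_succ hi.2⟩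
        ⟨hj.1, hj.2.trans (Nat.le_succ m)⟩ hij)).trans (hb j hj).1
  have hline := hg.linePoly_sigma A
  rw [hder] at hline
  rw [eigenvalue_eq (by positivity) hbmono hline hk]
  exact ⟨(hb k hk).1, (hb k hk).2.1, fun h => ((hb k hk).2.2 h).1,
    sign_sum_inv ha hk (hb k hk).2.2 hder⟩

/-- The Gårding cone of `g` lies in that of the penultimate `σ_j` by interlacing, so its closure
inherits the positive semidefinite matrices. -/
theorem sigma_penultimate (hg : IsGardingDirichlet (m + 1) g) :
    IsGardingDirichlet m (sigma (m + 1) g m) := by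
  have hhom : (sigma (m + 1) g m).IsHomogeneous m := by
    rw [sigma, Nat.add_sub_cancel_left]
    exact (isHomogeneous_coeff_genericLine hg.homogeneous (add_comm 1 m)).C_mul _
  have hfac : ∀ A, ∃ b : ℕ → ℝ, linePoly (sigma (m + 1) g m) A =
      C ((m : ℝ) + 1) * ∏ i ∈ Finset.Icc 1 m, (X + C (b i)) := fun A => by
    obtain ⟨b, -, hder⟩ := exists_interlacing_derivative_prod (hg.monotoneOn_eigenvalue A)
    exact ⟨b, (hg.linePoly_sigma A).trans hder⟩
  have hid : (sigma (m + 1) g m).val (SymMat.id n) ≠ 0 := by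
    have h := eval_linePoly (sigma (m + 1) g m) 0 1
    rw [one_smul, add_zero, linePoly_sigma_penultimate, linePoly_zero hg.homogeneous] at h
    rw [← h, derivative_C_mul_X_pow, eval_mul, eval_C, eval_mul, eval_C, eval_pow, eval_X, one_pow,
      mul_one]
    exact mul_ne_zero (inv_ne_zero hg.val_id_ne_zero)
      (mul_ne_zero hg.val_id_ne_zero (Nat.cast_ne_zero.2 m.succ_ne_zero))
  have hsplits : ∀ A, (linePoly (sigma (m + 1) g m) A).Splits := fun A => by
    obtain ⟨b, hb⟩ := hfac A
    rw [hb]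
    exact (Splits.C _).mul (Splits.prod fun i _ => Splits.X_add_C _)
  refine ⟨hhom, hid, hsplits, fun A hA => closure_mono (fun B hB x hx => ?_)
    (hg.posSemidef_mem A hA)⟩
  obtain ⟨b, hb, hder⟩ := exists_interlacing_derivative_prod (hg.monotoneOn_eigenvalue B)
  have hroot : (linePoly (sigma (m + 1) g m) B).IsRoot (-x) := by
    rw [eigenvalues, Multiset.mem_sort, Multiset.mem_map] at hx
    obtain ⟨r, hr, rfl⟩ := hx
    rw [neg_neg]
    exact isRoot_of_mem_roots hr
  rw [hg.linePoly_sigma B, hder, IsRoot, eval_mul, eval_C, eval_prod, mul_eq_zero,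
    or_iff_right (by positivity), Finset.prod_eq_zero_iff] at hroot
  obtain ⟨k, hk, hkx⟩ := hroot
  rw [Finset.mem_Icc] at hk
  have hxk : x = b k := by
    simp only [eval_add, eval_X, eval_C] at hkx
    linarith
  have hpos : 0 < g.eigenvalue k B := by
    refine hB _ ?_
    rw [hg.eigenvalue_eq_getElem ⟨hk.1, by omega⟩]
    exact List.getElem_mem _
  rw [hxk]
  exact hpos.trans_le (hb k hk).1

/-- If no eigenvalue vanishes, then `σ_{m-1} σ_m` has the sign of the sum of the reciprocals. -/
theorem sigma_mul_sigma_neg_iff (hg : IsGardingDirichlet (m + 1) g) {A : SymMat n}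
    (hne : ∀ i ∈ Finset.Icc 1 (m + 1), g.eigenvalue i A ≠ 0) :
    (sigma (m + 1) g m).val A * (sigma (m + 1) g (m + 1)).val A < 0 ↔
      ∑ i ∈ Finset.Icc 1 (m + 1), (g.eigenvalue i A)⁻¹ < 0 := by
  have h : (sigma (m + 1) g m).val A = (∏ i ∈ Finset.Icc 1 (m + 1), g.eigenvalue i A) *
      ∑ i ∈ Finset.Icc 1 (m + 1), (g.eigenvalue i A)⁻¹ := by
    have h0 := eval_linePoly (sigma (m + 1) g m) A 0
    rw [zero_smul, zero_add] at h0
    rw [← h0, hg.linePoly_sigma, eval_derivative_prod_X_add_C (by simpa using hne)]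
    simp
  have hprod : 0 < (∏ i ∈ Finset.Icc 1 (m + 1), g.eigenvalue i A) ^ 2 :=
    sq_pos_of_ne_zero (Finset.prod_ne_zero_iff.2 hne)
  rw [h, hg.val_sigma_top, mul_right_comm, ← sq, mul_neg_iff]
  simp [hprod, hprod.not_gt]

theorem eigenvalue_ne_zero (hg : IsGardingDirichlet (m + 1) g) {A : SymMat n} {k : ℕ}
    (hk : k ∈ Set.Icc 1 m) (hneg : g.eigenvalue k A < 0) (hpos : 0 < g.eigenvalue (k + 1) A) :
    ∀ i ∈ Finset.Icc 1 (m + 1), g.eigenvalue i A ≠ 0 := by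
  intro i hi
  rw [Finset.mem_Icc] at hi
  have hmono := hg.monotoneOn_eigenvalue A
  rcases le_or_gt i k with h | h
  · exact ((hmono hi ⟨hk.1, hk.2.trans (Nat.le_succ m)⟩ h).trans_lt hneg).ne
  · exact (hpos.trans_le (hmono ⟨by omega, Nat.succ_le_succ hk.2⟩ hi h)).ne'

/-- Positivity of the eigenvalues of the penultimate `σ_j` in terms of those of `g`. -/
theorem eigenvalue_sigma_pos_iff (hg : IsGardingDirichlet (m + 1) g) (A : SymMat n) {k : ℕ}
    (hk : k ∈ Set.Icc 1 m) :
    0 < (sigma (m + 1) g m).eigenvalue k A ↔ 0 < g.eigenvalue (k + 1) A ∧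
      (0 ≤ g.eigenvalue k A ∨ g.eigenvalue k A < 0 ∧
        (sigma (m + 1) g m).val A * (sigma (m + 1) g (m + 1)).val A < 0) := by
  obtain ⟨h1, h2, h3, h4⟩ := hg.interlacing A hk
  constructor
  · intro h
    refine ⟨h.trans_le h2, (le_or_gt 0 (g.eigenvalue k A)).imp_right fun hneg => ⟨hneg, ?_⟩⟩
    rw [hg.sigma_mul_sigma_neg_iff (hg.eigenvalue_ne_zero hk hneg (h.trans_le h2))]
    exact (h4 hneg (h.trans_le h2)).1.2 h
  · rintro ⟨hpos, hnonneg | ⟨hneg, h⟩⟩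
    · rcases hnonneg.eq_or_lt with h | h
      · exact h.trans_lt (h3 (h ▸ hpos))
      · exact h.trans_le h1
    · rw [hg.sigma_mul_sigma_neg_iff (hg.eigenvalue_ne_zero hk hneg hpos)] at h
      exact (h4 hneg hpos).1.1 h

theorem interior_branch_sigma (hg : IsGardingDirichlet (m + 1) g) {k : ℕ} (hk1 : 1 ≤ k)
    (hk2 : k ≤ m + 1) :
    interior ((sigma (m + 1) g m).branch k) =
      (interior (g.branch (k + 1)) ∩ g.branch k) ∪ exceptionalPart (m + 1) g k := by
  rcases hk2.eq_or_lt with rfl | hlt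
  · rw [hg.sigma_penultimate.branch_of_lt (Nat.lt_succ_self m), exceptionalPart,
      hg.branch_of_lt (Nat.lt_succ_self (m + 1)), interior_univ, Set.univ_inter,
      Nat.add_sub_cancel, eq_comm, Set.eq_univ_iff_forall]
    intro A
    rcases le_or_gt 0 (g.eigenvalue (m + 1) A) with h | h
    · exact Or.inl h
    · have hneg : ∀ i ∈ Finset.Icc 1 (m + 1), g.eigenvalue i A < 0 := fun i hi => by
        rw [Finset.mem_Icc] at hi
        exact (hg.monotoneOn_eigenvalue A hi ⟨hk1, le_rfl⟩ hi.2).trans_lt h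
      refine Or.inr ⟨⟨trivial, not_le.2 h⟩, ?_⟩
      change (sigma (m + 1) g m).val A * (sigma (m + 1) g (m + 1)).val A < 0
      rw [hg.sigma_mul_sigma_neg_iff fun i hi => (hneg i hi).ne]
      exact Finset.sum_neg (fun i hi => inv_lt_zero.2 (hneg i hi)) ⟨1, by simp⟩
  · have hk : k ∈ Set.Icc 1 m := ⟨hk1, Nat.lt_succ_iff.1 hlt⟩
    rw [hg.sigma_penultimate.interior_branch hk, exceptionalPart,
      hg.interior_branch ⟨by omega, by omega⟩, Nat.add_sub_cancel]
    ext A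
    rw [Set.mem_ofPred_eq, hg.eigenvalue_sigma_pos_iff A hk]
    simp only [branch, Set.mem_union, Set.mem_inter_iff, Set.mem_sdiff, Set.mem_ofPred_eq, not_le]
    tauto

/-! ### Asymptotic interiors -/

open Filter in
/-- Membership in the asymptotic interior is a statement about arctangents along a ray. -/
theorem mem_asymptoticInterior_iff (hg : IsGardingDirichlet m g) {θ : ℝ} {A : SymMat n} :
    A ∈ asymptoticInterior (slSubequation m g θ) ↔ ∃ ε > (0 : ℝ), ∀ᶠ t : ℝ in atTop,
      θ ≤ ∑ k ∈ Finset.Icc 1 m, Real.arctan (t * g.eigenvalue k (A - ε • SymMat.id n)) := by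
  have h : ∀ (ε : ℝ) {t : ℝ}, 0 < t →
      (t • (A - ε • SymMat.id n) ∈ slSubequation m g θ ↔
        θ ≤ ∑ k ∈ Finset.Icc 1 m, Real.arctan (t * g.eigenvalue k (A - ε • SymMat.id n))) := by
    intro ε t ht
    rw [slSubequation, Set.mem_ofPred_eq, slOperator, Finset.sum_congr rfl fun k hk => by
      rw [hg.eigenvalue_smul _ ht (Finset.mem_Icc.1 hk)]]
  refine exists_congr fun ε => and_congr_right fun _ => ?_
  rw [← eventually_atTop]
  exact eventually_congr ((eventually_gt_atTop 0).mono fun t ht => h ε ht)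

/-- In the `k`-th open phase interval the limit of the operator along rays decides, and it
jumps exactly when the `k`-th eigenvalue changes sign. -/
theorem asymptoticInterior_of_mem_phaseInterval (hg : IsGardingDirichlet m g) {k : ℕ}
    (hk : k ∈ Set.Icc 1 m) {θ : ℝ} (hθ : θ ∈ phaseInterval m k) :
    asymptoticInterior (slSubequation m g θ) = {A | 0 < g.eigenvalue k A} := by
  ext A
  rw [hg.mem_asymptoticInterior_iff, Set.mem_ofPred_eq]
  have hpi := half_pos Real.pi_pos
  constructor
  · rintro ⟨ε, hε, h⟩
    by_contra hcon
    have hneg : g.eigenvalue k (A - ε • SymMat.id n) < 0 := by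
      rw [hg.eigenvalue_sub_smul_id A ε hk]
      linarith
    have h1 := ge_of_tendsto (tendsto_sum_arctan_mul _ _) h
    have h2 := mul_le_mul_of_nonneg_right
      (sum_sign_le (hg.monotoneOn_eigenvalue (A - ε • SymMat.id n)) hk hneg) hpi.le
    exact absurd hθ.1 (not_lt.2 (h1.trans h2))
  · intro hpos
    refine ⟨g.eigenvalue k A / 2, half_pos hpos, ?_⟩
    set B := A - (g.eigenvalue k A / 2) • SymMat.id n with hB
    obtain ⟨j, rfl⟩ : ∃ j, k = j + 1 := ⟨k - 1, by have := hk.1; omega⟩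
    have hposB : 0 < g.eigenvalue (j + 1) B := by
      rw [hB, hg.eigenvalue_sub_smul_id A _ hk]
      linarith
    have h1 := mul_le_mul_of_nonneg_right
      (le_sum_sign (hg.monotoneOn_eigenvalue B) hk.2 hposB) hpi.le
    have h2 := hθ.2
    push_cast at h2
    rw [add_sub_cancel_right] at h2
    exact ((tendsto_sum_arctan_mul _ _).eventually_const_lt (h2.trans_le h1)).mono fun t ht => ht.le

open Filter in
/-- At the special phase `θ_k` the limit along a ray with `λ_k < 0 < λ_{k+1}` equals `θ_k`, and the
first-order term, the sum of the reciprocals of the eigenvalues, decides. -/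
theorem asymptoticInterior_specialPhase (hg : IsGardingDirichlet (m + 1) g) {k : ℕ}
    (hk : k ∈ Set.Icc 1 m) :
    asymptoticInterior (slSubequation (m + 1) g (specialPhase (m + 1) k)) =
      {A | 0 < (sigma (m + 1) g m).eigenvalue k A} := by
  have hs := hg.sigma_penultimate
  have hk1 : k ∈ Set.Icc 1 (m + 1) := ⟨hk.1, hk.2.trans (Nat.le_succ m)⟩
  have hpi := half_pos Real.pi_pos
  ext A
  rw [hg.mem_asymptoticInterior_iff, Set.mem_ofPred_eq]
  constructor
  · rintro ⟨ε, hε, h⟩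
    set B := A - ε • SymMat.id n with hB
    suffices hnonneg : 0 ≤ (sigma (m + 1) g m).eigenvalue k B by
      rw [hB, hs.eigenvalue_sub_smul_id A ε hk] at hnonneg
      linarith
    obtain ⟨i1, -, -, i4⟩ := hg.interlacing B hk
    by_contra! hcon
    have hneg := i1.trans_lt hcon
    have hmono := hg.monotoneOn_eigenvalue B
    have hpos : 0 < g.eigenvalue (k + 1) B := by
      by_contra! hnonpos
      have h1 := ge_of_tendsto (tendsto_sum_arctan_mul _ _) h
      have h2 := mul_lt_mul_of_pos_right (sum_sign_lt hmono hk hneg hnonpos) hpi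
      exact absurd (h1.trans_lt h2) (lt_irrefl _)
    refine hcon.not_ge ((i4 hneg hpos).2.1 ?_)
    refine le_of_tendsto (tendsto_mul_sum_arctan_mul_inv _ _) ?_
    filter_upwards [h, eventually_gt_atTop 0] with t ht ht0
    rw [sum_arctan_mul_eq hmono hk hneg hpos ht0] at ht
    exact mul_nonpos_of_nonneg_of_nonpos ht0.le (by linarith)
  · intro hpos
    rcases lt_or_ge 0 (g.eigenvalue k A) with hA | hA
    · have hθ : specialPhase (m + 1) k + Real.pi / 2 ∈ phaseInterval (m + 1) k := by
        constructor <;> rw [specialPhase] <;> linarith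
      have hmem : A ∈ asymptoticInterior
          (slSubequation (m + 1) g (specialPhase (m + 1) k + Real.pi / 2)) := by
        rw [hg.asymptoticInterior_of_mem_phaseInterval hk1 hθ]
        exact hA
      obtain ⟨ε, hε, h⟩ := hg.mem_asymptoticInterior_iff.1 hmem
      exact ⟨ε, hε, h.mono fun t ht => (le_add_of_nonneg_right hpi.le).trans ht⟩
    · set ε := (sigma (m + 1) g m).eigenvalue k A / 2 with hε
      refine ⟨ε, half_pos hpos, ?_⟩
      set B := A - ε • SymMat.id n with hB
      have hposB : 0 < (sigma (m + 1) g m).eigenvalue k B := by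
        rw [hB, hs.eigenvalue_sub_smul_id A ε hk]
        linarith
      obtain ⟨-, i2, -, i4⟩ := hg.interlacing B hk
      have hneg : g.eigenvalue k B < 0 := by
        rw [hB, hg.eigenvalue_sub_smul_id A ε hk1]
        linarith
      have hposg := hposB.trans_le i2
      filter_upwards [(tendsto_mul_sum_arctan_mul_inv _ _).eventually_lt_const
        ((i4 hneg hposg).1.2 hposB), eventually_gt_atTop 0] with t ht ht0
      rw [sum_arctan_mul_eq (hg.monotoneOn_eigenvalue B) hk hneg hposg ht0]
      linarith [(pos_iff_neg_of_mul_neg ht).1 ht0]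

end IsGardingDirichlet

end SymPoly

end

/-! ### Asymptotic subequations -/

theorem mainTheorem6 (n m : ℕ) (hm : 1 ≤ m) (g : SymPoly n)
    (hg : SymPoly.IsGardingDirichlet m g) :
    -- the polynomial `σ_{m-1}` is itself Gårding–Dirichlet, of degree `m - 1`
    SymPoly.IsGardingDirichlet (m - 1) (SymPoly.sigma m g (m - 1)) ∧
    -- phases in the open phase intervals
    (∀ k : ℕ, 1 ≤ k → k ≤ m → ∀ θ ∈ phaseInterval m k,
      asymptoticSubequation (SymPoly.slSubequation m g θ) = g.branch k ∧
      interior (asymptoticSubequation (SymPoly.slSubequation m g θ)) = interior (g.branch k) ∧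
      interior (g.branch k) = {A | 0 < g.eigenvalue k A}) ∧
    -- special phases
    (∀ k : ℕ, 1 ≤ k → k ≤ m - 1 →
      asymptoticSubequation (SymPoly.slSubequation m g (specialPhase m k)) =
        (SymPoly.sigma m g (m - 1)).branch k ∧
      interior (asymptoticSubequation (SymPoly.slSubequation m g (specialPhase m k))) =
        (interior (g.branch (k + 1)) ∩ g.branch k) ∪ exceptionalPart m g k) ∧
    -- the interior of the branches of `σ_{m-1}` is a disjoint union
    (∀ k : ℕ, 1 ≤ k → k ≤ m →
      interior ((SymPoly.sigma m g (m - 1)).branch k) =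
        (interior (g.branch (k + 1)) ∩ g.branch k) ∪ exceptionalPart m g k ∧
      Disjoint (interior (g.branch (k + 1)) ∩ g.branch k) (exceptionalPart m g k)) := by
  obtain ⟨d, rfl⟩ : ∃ d, m = d + 1 := ⟨m - 1, by omega⟩
  simp only [Nat.add_sub_cancel]
  have hs := hg.sigma_penultimate
  refine ⟨hs, fun k hk1 hk2 θ hθ => ?_, fun k hk1 hk2 => ?_, fun k hk1 hk2 =>
    ⟨hg.interior_branch_sigma hk1 hk2, ?_⟩⟩
  · have hk : k ∈ Set.Icc 1 (d + 1) := ⟨hk1, hk2⟩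
    have h : asymptoticSubequation (SymPoly.slSubequation (d + 1) g θ) = g.branch k := by
      rw [asymptoticSubequation, hg.asymptoticInterior_of_mem_phaseInterval hk hθ,
        hg.closure_eigenvalue_pos hk]
    exact ⟨h, by rw [h], hg.interior_branch hk⟩
  · have hk : k ∈ Set.Icc 1 d := ⟨hk1, hk2⟩
    have h : asymptoticSubequation
        (SymPoly.slSubequation (d + 1) g (specialPhase (d + 1) k)) =
          (SymPoly.sigma (d + 1) g d).branch k := by
      rw [asymptoticSubequation, hg.asymptoticInterior_specialPhase hk,
        hs.closure_eigenvalue_pos hk]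
    exact ⟨h, by rw [h, hg.interior_branch_sigma hk1 (hk2.trans (Nat.le_succ d))]⟩
  · exact Set.disjoint_left.2 fun A hA hE => hE.1.2 hA.2
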